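/- Let $S=\mathbb{C}[x,y,z]$, let $d\ge 3$, and let $C:f=0$ be a reduced curve of degree $d$ in the complex projective plane, with Jacobian ideal $J_f=(f_x,f_y,f_z)$, Milnor algebra $M(f)=S/J_f$ and module of Jacobian syzygies $$D_0(f)=\{(a,b,c)\in S^3 : af_x+bf_y+cf_z=0\}.$$ Suppose that $C$ is of type $(d,r,m)$, that is, $D_0(f)$ is minimally generated by $m$ homogeneous syzygies, all of the same degree $r$. Let $\tau(C)$ be the total Tjurina number of $C$, i.e. the degree of the ideal $J_f$, which is the value of $\dim_{\mathbb{C}} M(f)_k$ for all large $k$. Put $\Delta m=(2r-d+3)-m$, and assume that $m>3$ and $\Delta m=2$. Then $\tau(C)$ is well defined, and $M(f)$ has a minimal graded free resolution of the form $$0\to\bigoplus_{i=1}^{m-2}S(-e_i)\to S(1-d-r)^m\to S^3(1-d)\to S$$ with $e_1\le\dots\le e_{m-2}$, where the last map is $(a,b,c)\mapsto af_x+bf_y+cf_z$. For every such resolution, define integers $\epsilon_j$ by $e_j=d+r-1+\epsilon_j$ for $1\le j\le m-2$. Then exactly one of the following two cases holds: 1. $\epsilon_{m-2}=3$, $\epsilon_j=1$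 for $1\le j\le m-3$, and $\tau(C)=\dfrac{d(d-1)}{2}-3+r(d-r-2)$; 2. $\epsilon_{m-2}=\epsilon_{m-3}=2$, $\epsilon_j=1$ for $1\le j\le m-4$, and $\tau(C)=\dfrac{d(d-1)}{2}-2+r(d-r-2)$. -/

import Mathlib

/-- The polynomial ring `S = ℂ[x, y, z]` with its standard grading. -/
abbrev PolyS : Type := MvPolynomial (Fin 3) ℂ

/-- `f = 0` is a reduced curve of degree `d ≥ 3` in the complex projective plane. -/
structure IsReducedPlaneCurve (d : ℕ) (f : PolyS) : Prop where
  three_le : 3 ≤ d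
  isHomogeneous : f.IsHomogeneous d
  squarefree : Squarefree f

/-- The `S`-linear map `S³ → S`, `(a, b, c) ↦ a f_x + b f_y + c f_z`. -/
noncomputable def jacobianMap (f : PolyS) : (Fin 3 → PolyS) →ₗ[PolyS] PolyS :=
  Fintype.linearCombination PolyS (fun i => MvPolynomial.pderiv i f)

/-- The module `D₀(f)` of Jacobian syzygies of `f`. -/
noncomputable def jacobianSyzygies (f : PolyS) : Submodule PolyS (Fin 3 → PolyS) :=
  LinearMap.ker (jacobianMap f)

/-- The Jacobian ideal `J_f = (f_x, f_y, f_z)`. -/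
noncomputable def jacobianIdeal (f : PolyS) : Ideal PolyS :=
  Ideal.span (Set.range fun i : Fin 3 => MvPolynomial.pderiv i f)

/-- `ρ_1, …, ρ_m` is a minimal set of homogeneous generators of `D₀(f)`, with
`deg ρ_j = dd j` and the degrees in increasing order. -/
structure IsMinimalSyzygyGenerators (f : PolyS) {m : ℕ} (dd : Fin m → ℕ)
    (ρ : Fin m → Fin 3 → PolyS) : Prop where
  monotone : Monotone dd
  isHomogeneous : ∀ j i, (ρ j i).IsHomogeneous (dd j)
  span_eq : Submodule.span PolyS (Set.range ρ) = jacobianSyzygies f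
  minimal : ∀ j, Submodule.span PolyS (ρ '' {j}ᶜ) ≠ jacobianSyzygies f

/-- `C : f = 0` is a curve of type `(d, r, m)`: a reduced plane curve of degree `d` such that
`D₀(f)` is minimally generated by `m` homogeneous syzygies, all of the same degree `r`. -/
def IsCurveOfType (d r m : ℕ) (f : PolyS) : Prop :=
  IsReducedPlaneCurve d f ∧
    ∃ ρ : Fin m → Fin 3 → PolyS, IsMinimalSyzygyGenerators f (fun _ => r) ρ

/-- `Δm = m(d,r)_max - m`, where `m(d,r)_max = 2r - d + 3`. -/
def deltaM (d r m : ℕ) : ℤ := (2 * (r : ℤ) - d + 3) - m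

/-- The matrices `ρ` and `σ` give a minimal graded free resolution of the Milnor algebra
`M(f) = S / J_f`, of the form
`0 → ⨁_{i=1}^{m-2} S(-e_i) → ⨁_{j=1}^m S(1-d-d_j) → S³(1-d) → S`,
where `e_1 ≤ … ≤ e_{m-2}` and `d_1 ≤ … ≤ d_m`, and where the last map is `jacobianMap f`.
The generator of `S(1-d-d_j)` goes to `ρ j`, and that of `S(-e_i)` goes to `σ i`. -/
structure IsMinimalMilnorResolution (f : PolyS) (d : ℕ) {m : ℕ}
    (dd : Fin m → ℕ) (e : Fin (m - 2) → ℕ)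
    (ρ : Fin m → Fin 3 → PolyS) (σ : Fin (m - 2) → Fin m → PolyS) : Prop where
  monotone_dd : Monotone dd
  monotone_e : Monotone e
  /-- the middle map is homogeneous of degree zero -/
  homogeneous_ρ : ∀ j i, (ρ j i).IsHomogeneous (dd j)
  /-- the left map is homogeneous of degree zero: the entry `σ i j` is homogeneous of degree
  `e_i - (d - 1) - d_j`, and it is zero if that number is negative -/
  homogeneous_σ : ∀ i j, σ i j = 0 ∨
    ∃ n : ℕ, (n : ℤ) = (e i : ℤ) - ((d : ℤ) - 1) - (dd j : ℤ) ∧ (σ i j).IsHomogeneous n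
  injective : Function.Injective (Fintype.linearCombination PolyS σ)
  exact_middle : Function.Exact (Fintype.linearCombination PolyS σ)
    (Fintype.linearCombination PolyS ρ)
  exact_right : Function.Exact (Fintype.linearCombination PolyS ρ) (jacobianMap f)
  /-- minimality: all entries of the three matrices lie in the ideal `(x, y, z)` -/
  minimal_f : ∀ i, MvPolynomial.constantCoeff (MvPolynomial.pderiv i f) = 0
  minimal_ρ : ∀ j i, MvPolynomial.constantCoeff (ρ j i) = 0
  minimal_σ : ∀ i j, MvPolynomial.constantCoeff (σ i j) = 0

/-- The integers `ε_j`, `1 ≤ j ≤ m - 2`, defined by `e_j = d + d_{j+2} - 1 + ε_j`.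
The element `j` of `Fin (m - 2)` stands for the index `j + 1`. -/
def resolutionEpsilon (d : ℕ) {m : ℕ} (dd : Fin m → ℕ) (e : Fin (m - 2) → ℕ)
    (j : Fin (m - 2)) : ℤ :=
  (e j : ℤ) - ((d : ℤ) + (dd ⟨(j : ℕ) + 2, by omega⟩ : ℤ) - 1)

/-- `dim_ℂ (S / I)_k`, the Hilbert function of `S / I` at `k`, where `(S / I)_k` is the image
in `S / I` of the space of homogeneous polynomials of degree `k`. -/
noncomputable def hilbertFunction (I : Ideal PolyS) (k : ℕ) : ℕ :=
  Module.finrank ℂ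
    ((MvPolynomial.homogeneousSubmodule (Fin 3) ℂ k).map (Ideal.Quotient.mkₐ ℂ I).toLinearMap)

/-- The total Tjurina number of `C : f = 0` is `τ`. It is the degree of the Jacobian ideal `J_f`,
that is, the degree of the (zero-dimensional or empty) subscheme of the projective plane which
`J_f` defines: the Hilbert polynomial of `S / J_f` is the constant `τ`. -/
def HasTotalTjurinaNumber (f : PolyS) (τ : ℕ) : Prop :=
  ∀ᶠ k in Filter.atTop, hilbertFunction (jacobianIdeal f) k = τ

/-!
The kernel of `⨁ S(1-d-d_j) → S³(1-d)` is the kernel of the first of two consecutive maps of free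
modules, so `x, y, z` is a regular sequence on it. Relations between minimal homogeneous generators
have coefficients in `(x, y, z)`, so by regularity the module `N` of these relations satisfies
`N = (x, y, z) N` and vanishes: the kernel is free. Its rank is `m - 2`, since `D₀(f)` has rank two.

The resolution makes the Hilbert function of `M(f)` an affine function of large `k`. As `f` is
squarefree, `J_f` contains two coprime forms of degree `d - 1`, so this function is bounded. Hence
its slope vanishes, which for generators of equal degree `r` says `∑ (ε_j - 1) = Δm`, and its
constant term is `τ(C) = d(d-1)/2 + r(d-r-2) - ∑ ε_j(ε_j-1)/2`. With `1 ≤ ε_1 ≤ … ≤ ε_{m-2}`, the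
equation `∑ (ε_j - 1) = 2` has the two solutions of the theorem.
-/

open MvPolynomial

/-! ### Graded pieces of free modules over a polynomial ring -/

section Graded

variable {σ R : Type*} [CommRing R]

/-- The projection of a polynomial to its part of degree `a`. Degrees are integers, so that the
degree `k` part of the twist `S(-e)` is the degree `k - e` part of `S` for all `k` and `e`. -/
noncomputable def degreeComponent : ℤ → MvPolynomial σ R →ₗ[R] MvPolynomial σ R
  | (n : ℕ) => homogeneousComponent n
  | Int.negSucc _ => 0

variable (σ R) in
/-- The space of homogeneous polynomials of degree `a : ℤ`, which is zero if `a < 0`. -/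
noncomputable def degreePart (a : ℤ) : Submodule R (MvPolynomial σ R) :=
  LinearMap.range (degreeComponent a)

theorem degreeComponent_natCast (n : ℕ) :
    degreeComponent (n : ℤ) = homogeneousComponent (σ := σ) (R := R) n := rfl

theorem degreeComponent_of_neg {a : ℤ} (ha : a < 0) :
    degreeComponent (σ := σ) (R := R) a = 0 := by
  obtain ⟨n, rfl⟩ := Int.eq_negSucc_of_lt_zero ha
  rfl

theorem degreePart_natCast (n : ℕ) : degreePart σ R (n : ℤ) = homogeneousSubmodule σ R n := by
  ext p
  refine ⟨?_, fun hp => ⟨p, homogeneousComponent_eq_self hp⟩⟩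
  rintro ⟨q, rfl⟩
  exact homogeneousComponent_mem n q

theorem degreePart_of_neg {a : ℤ} (ha : a < 0) : degreePart σ R a = ⊥ := by
  rw [degreePart, degreeComponent_of_neg ha, LinearMap.range_zero]

theorem mem_degreePart_iff {a : ℤ} {p : MvPolynomial σ R} :
    p ∈ degreePart σ R a ↔ p = 0 ∨ ∃ n : ℕ, (n : ℤ) = a ∧ p.IsHomogeneous n := by
  rcases lt_or_ge a 0 with ha | ha
  · rw [degreePart_of_neg ha, Submodule.mem_bot]
    exact ⟨Or.inl, fun h => h.resolve_right (by rintro ⟨n, hn, -⟩; omega)⟩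
  · lift a to ℕ using ha
    rw [degreePart_natCast, mem_homogeneousSubmodule]
    refine ⟨fun hp => Or.inr ⟨a, rfl, hp⟩, ?_⟩
    rintro (rfl | ⟨n, hn, hp⟩)
    · exact isHomogeneous_zero σ R a
    · rwa [← Nat.cast_injective hn]

theorem degreeComponent_mem (a : ℤ) (p : MvPolynomial σ R) :
    degreeComponent a p ∈ degreePart σ R a :=
  LinearMap.mem_range_self _ p

theorem degreeComponent_of_mem {a : ℤ} {p : MvPolynomial σ R} (hp : p ∈ degreePart σ R a) :
    degreeComponent a p = p := by
  rcases mem_degreePart_iff.1 hp with rfl | ⟨n, rfl, hn⟩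
  · exact map_zero _
  · exact homogeneousComponent_eq_self hn

theorem degreeComponent_comp_self (a : ℤ) :
    degreeComponent (σ := σ) (R := R) a ∘ₗ degreeComponent a = degreeComponent a :=
  LinearMap.ext fun p => degreeComponent_of_mem (degreeComponent_mem a p)

attribute [local instance] MvPolynomial.gradedAlgebra in
theorem homogeneousComponent_mul_of_isHomogeneous {q : MvPolynomial σ R} {n : ℕ}
    (hq : q.IsHomogeneous n) (p : MvPolynomial σ R) (k : ℕ) :
    homogeneousComponent k (p * q) = if n ≤ k then homogeneousComponent (k - n) p * q else 0 := by
  have h := DirectSum.coe_decompose_mul_of_right_mem (homogeneousSubmodule σ R) k (a := p)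
    ((mem_homogeneousSubmodule n q).2 hq)
  have component_eq (p : MvPolynomial σ R) (k : ℕ) :
      (DirectSum.decompose (homogeneousSubmodule σ R) p k : MvPolynomial σ R) =
        homogeneousComponent k p := decomposition.decompose'_apply p k
  simpa only [component_eq] using h

theorem degreeComponent_mul {b : ℤ} {q : MvPolynomial σ R} (hq : q ∈ degreePart σ R b)
    (a : ℤ) (p : MvPolynomial σ R) :
    degreeComponent a (p * q) = degreeComponent (a - b) p * q := by
  rcases mem_degreePart_iff.1 hq with rfl | ⟨n, rfl, hn⟩
  · simp only [mul_zero, map_zero]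
  rcases lt_or_ge a 0 with ha | ha
  · simp only [degreeComponent_of_neg ha, degreeComponent_of_neg (show a - n < 0 by omega),
      LinearMap.zero_apply, zero_mul]
  lift a to ℕ using ha
  rw [degreeComponent_natCast, homogeneousComponent_mul_of_isHomogeneous hn]
  split_ifs with hna
  · rw [← Nat.cast_sub hna, degreeComponent_natCast]
  · rw [degreeComponent_of_neg (by omega), LinearMap.zero_apply, zero_mul]

variable {ι κ : Type*}

/-- The projection of the free module `⨁ S(-e i)` to its degree `k` part. -/
noncomputable def freeComponent (e : ι → ℤ) (k : ℤ) :
    (ι → MvPolynomial σ R) →ₗ[R] (ι → MvPolynomial σ R) :=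
  LinearMap.piMap fun i => degreeComponent (k - e i)

/-- The rows of the matrix `A` define a map `⨁ S(-e i) → ⨁ S(-c j)` of degree zero. -/
def IsHomogeneousMatrix (e : ι → ℤ) (c : κ → ℤ) (A : ι → κ → MvPolynomial σ R) : Prop :=
  ∀ i j, A i j ∈ degreePart σ R (e i - c j)

theorem freeComponent_apply (e : ι → ℤ) (k : ℤ) (v : ι → MvPolynomial σ R) (i : ι) :
    freeComponent e k v i = degreeComponent (k - e i) (v i) := rfl

theorem freeComponent_comp_self (e : ι → ℤ) (k : ℤ) :
    freeComponent (σ := σ) (R := R) e k ∘ₗ freeComponent e k = freeComponent e k :=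
  LinearMap.ext fun v => funext fun i => degreeComponent_of_mem (degreeComponent_mem _ (v i))

theorem degreeComponent_linearCombination [Fintype ι] {e : ι → ℤ} {c : ι → MvPolynomial σ R}
    (hc : ∀ i, c i ∈ degreePart σ R (e i)) (k : ℤ) (v : ι → MvPolynomial σ R) :
    degreeComponent k (Fintype.linearCombination (MvPolynomial σ R) c v) =
      Fintype.linearCombination (MvPolynomial σ R) c (freeComponent e k v) := by
  simp only [Fintype.linearCombination_apply, map_sum, smul_eq_mul, freeComponent_apply,
    degreeComponent_mul (hc _)]

theorem freeComponent_linearCombination [Fintype ι] {e : ι → ℤ} {c : κ → ℤ}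
    {A : ι → κ → MvPolynomial σ R} (hA : IsHomogeneousMatrix e c A) (k : ℤ)
    (v : ι → MvPolynomial σ R) :
    freeComponent c k (Fintype.linearCombination (MvPolynomial σ R) A v) =
      Fintype.linearCombination (MvPolynomial σ R) A (freeComponent e k v) := by
  funext j
  simp only [freeComponent_apply, Fintype.linearCombination_apply, Finset.sum_apply,
    Pi.smul_apply, smul_eq_mul, map_sum, degreeComponent_mul (hA _ j), sub_sub_sub_cancel_right]

end Graded

/-! ### Dimensions of graded pieces -/

section Finrank

theorem finrank_range_comp_add_finrank_range_comp {K U V W : Type*} [DivisionRing K]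
    [AddCommGroup U] [Module K U] [AddCommGroup V] [Module K V] [AddCommGroup W] [Module K W]
    {A : V →ₗ[K] W} {B : W →ₗ[K] U} (hAB : Function.Exact A B) {p : V →ₗ[K] V} {q : W →ₗ[K] W}
    (hq : q ∘ₗ q = q) (hqA : q ∘ₗ A = A ∘ₗ p) [Module.Finite K (LinearMap.range q)] :
    Module.finrank K (LinearMap.range (B ∘ₗ q)) + Module.finrank K (LinearMap.range (A ∘ₗ p)) =
      Module.finrank K (LinearMap.range q) := by
  have hker : (LinearMap.ker (B.domRestrict (LinearMap.range q))).map
      (LinearMap.range q).subtype = LinearMap.range (A ∘ₗ p) := by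
    ext w
    constructor
    · rintro ⟨⟨_, w, rfl⟩, hw, rfl⟩
      obtain ⟨v, hv⟩ := (hAB (q w)).1 hw
      refine ⟨v, ?_⟩
      rw [← hqA, LinearMap.comp_apply, hv, ← LinearMap.comp_apply, hq, Submodule.subtype_apply]
    · rintro ⟨v, rfl⟩
      have hBA : B ((A ∘ₗ p) v) = 0 := hAB.apply_apply_eq_zero (p v)
      rw [← hqA] at hBA ⊢
      exact ⟨⟨q (A v), LinearMap.mem_range_self q (A v)⟩, hBA, rfl⟩
  rw [← (B.domRestrict (LinearMap.range q)).finrank_range_add_finrank_ker, ← hker,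
    LinearMap.range_domRestrict, LinearMap.range_comp, Submodule.finrank_map_subtype_eq]

variable {σ K : Type*} [Field K]

theorem finrank_homogeneousSubmodule [Fintype σ] (n : ℕ) :
    Module.finrank K (homogeneousSubmodule σ K n) = (Fintype.card σ).multichoose n := by
  classical
  have hs : {d : σ →₀ ℕ | d.degree = n} = (Finset.univ.finsuppAntidiag n : Finset (σ →₀ ℕ)) := by
    ext d
    simp [Finset.mem_finsuppAntidiag, Finsupp.degree_eq_sum]
  rw [homogeneousSubmodule_eq_finsupp_supported, hs,
    LinearEquiv.finrank_eq (AddMonoidAlgebra.supportedEquivFinsupp _),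
    Module.finrank_finsupp_self]
  simp only [Finset.coe_sort_coe, Fintype.card_coe,
    Finset.card_finsuppAntidiag_nat_eq_multichoose, Finset.card_univ]

instance finite_degreePart [Finite σ] (a : ℤ) : Module.Finite K (degreePart σ K a) := by
  rcases lt_or_ge a 0 with ha | ha
  · rw [degreePart_of_neg ha]
    infer_instance
  · lift a to ℕ using ha
    rw [degreePart_natCast]
    exact Module.Finite.iff_fg.2 (homogeneousSubmodule_fg σ K a)

theorem two_mul_finrank_degreePart {a : ℤ} (ha : 0 ≤ a) :
    2 * (Module.finrank K (degreePart (Fin 3) K a) : ℤ) = (a + 1) * (a + 2) := by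
  lift a to ℕ using ha
  rw [degreePart_natCast, finrank_homogeneousSubmodule, Fintype.card_fin,
    Nat.multichoose_eq, show 3 + a - 1 = a + 2 by omega, Nat.choose_symm_add]
  have hdvd : 2 ∣ (a + 2) * (a + 2 - 1) := (Nat.even_mul_pred_self _).two_dvd
  have hchoose : 2 * (a + 2).choose 2 = (a + 2) * (a + 1) := by
    rw [Nat.choose_two_right, Nat.mul_div_cancel' hdvd, show a + 2 - 1 = a + 1 by omega]
  rw [mul_comm ((a : ℤ) + 1)]
  exact_mod_cast hchoose

variable {ι κ : Type*} [Fintype ι]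

/-- The degree `k` part of the image of `⨁ S(-e i)` under a linear map. -/
noncomputable def gradedImage {M : Type*} [AddCommGroup M] [Module K M]
    [Module (MvPolynomial σ K) M] [IsScalarTower K (MvPolynomial σ K) M] (e : ι → ℤ) (k : ℤ)
    (A : (ι → MvPolynomial σ K) →ₗ[MvPolynomial σ K] M) : Submodule K M :=
  LinearMap.range (A.restrictScalars K ∘ₗ freeComponent e k)

/-- The degree `k` part of a free module is the product of the parts of its summands. -/
noncomputable def rangeFreeComponentEquiv (e : ι → ℤ) (k : ℤ) :
    LinearMap.range (freeComponent (σ := σ) (R := K) e k) ≃ₗ[K]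
      ∀ i, degreePart σ K (k - e i) where
  toFun v i := ⟨v.1 i, by obtain ⟨_, w, rfl⟩ := v; exact degreeComponent_mem _ _⟩
  invFun w := ⟨fun i => w i, fun i => w i, funext fun i => degreeComponent_of_mem (w i).2⟩
  map_add' _ _ := rfl
  map_smul' _ _ := rfl

theorem finrank_gradedImage_of_injective [Finite σ] {M : Type*} [AddCommGroup M] [Module K M]
    [Module (MvPolynomial σ K) M] [IsScalarTower K (MvPolynomial σ K) M]
    {A : (ι → MvPolynomial σ K) →ₗ[MvPolynomial σ K] M} (hA : Function.Injective A)
    (e : ι → ℤ) (k : ℤ) :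
    Module.finrank K (gradedImage e k A) = ∑ i, Module.finrank K (degreePart σ K (k - e i)) := by
  rw [gradedImage, LinearMap.range_comp, ← Module.finrank_pi_fintype,
    ← (rangeFreeComponentEquiv e k).finrank_eq]
  exact (Submodule.equivMapOfInjective (A.restrictScalars K) hA _).finrank_eq.symm

theorem finrank_gradedImage_add [Finite σ] [Fintype κ] {M : Type*} [AddCommGroup M] [Module K M]
    [Module (MvPolynomial σ K) M] [IsScalarTower K (MvPolynomial σ K) M]
    {e : ι → ℤ} {c : κ → ℤ} {A : ι → κ → MvPolynomial σ K} (hA : IsHomogeneousMatrix e c A)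
    {B : (κ → MvPolynomial σ K) →ₗ[MvPolynomial σ K] M}
    (hAB : Function.Exact (Fintype.linearCombination (MvPolynomial σ K) A) B) (k : ℤ) :
    Module.finrank K (gradedImage c k B) +
        Module.finrank K (gradedImage e k (Fintype.linearCombination (MvPolynomial σ K) A)) =
      ∑ j, Module.finrank K (degreePart σ K (k - c j)) := by
  have : Module.Finite K (LinearMap.range (freeComponent (σ := σ) (R := K) c k)) :=
    Module.Finite.equiv (rangeFreeComponentEquiv c k).symm
  rw [← Module.finrank_pi_fintype, ← (rangeFreeComponentEquiv c k).finrank_eq]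
  exact finrank_range_comp_add_finrank_range_comp
    (A := (Fintype.linearCombination (MvPolynomial σ K) A).restrictScalars K)
    (B := B.restrictScalars K) hAB (freeComponent_comp_self c k)
    (LinearMap.ext (freeComponent_linearCombination hA k))

end Finrank

theorem hilbertFunction_add_finrank_gradedImage {ι : Type*} [Fintype ι] {e : ι → ℤ}
    {c : ι → PolyS} (hc : ∀ i, c i ∈ degreePart (Fin 3) ℂ (e i)) (k : ℕ) :
    hilbertFunction (Ideal.span (Set.range c)) k +
        Module.finrank ℂ (gradedImage e k (Fintype.linearCombination PolyS c)) =
      Module.finrank ℂ (degreePart (Fin 3) ℂ k) := by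
  rw [hilbertFunction, ← degreePart_natCast, degreePart, ← LinearMap.range_comp]
  have hexact : Function.Exact ((Fintype.linearCombination PolyS c).restrictScalars ℂ)
      (Ideal.Quotient.mkₐ ℂ (Ideal.span (Set.range c))).toLinearMap := by
    intro p
    have hrange : LinearMap.range (Fintype.linearCombination PolyS c) =
        Ideal.span (Set.range c) := Fintype.range_linearCombination PolyS c
    rw [AlgHom.toLinearMap_apply, Ideal.Quotient.mkₐ_eq_mk, Ideal.Quotient.eq_zero_iff_mem,
      ← hrange]
    rfl
  have : Module.Finite ℂ (LinearMap.range (degreeComponent (σ := Fin 3) (R := ℂ) k)) :=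
    finite_degreePart k
  exact finrank_range_comp_add_finrank_range_comp hexact (degreeComponent_comp_self k)
    (LinearMap.ext (degreeComponent_linearCombination hc k))

/-! ### Regular sequences on syzygy modules -/

section RegularSequence

open RingTheory.Sequence

variable {R : Type*} [CommRing R] {F K M : Type*} [AddCommGroup F] [Module R F]
  [AddCommGroup K] [Module R K] [AddCommGroup M] [Module R M]

theorem injective_quotSMulTop_map {f : K →ₗ[R] F} {g : F →ₗ[R] M} (hf : Function.Injective f)
    (hfg : Function.Exact f g) {r : R} (hr : IsSMulRegular M r) :
    Function.Injective (QuotSMulTop.map r f) := by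
  have hexact := QuotSMulTop.map_first_exact_on_four_term_exact_of_isSMulRegular_last
    ((f.exact_zero_iff_injective K).2 hf) hfg hr
  rw [map_zero] at hexact
  exact (LinearMap.exact_zero_iff_injective _ _).1 hexact

theorem isWeaklyRegular_concat_of_exact {rs : List R} {a : R} {f : K →ₗ[R] F} {g : F →ₗ[R] M}
    (hf : Function.Injective f) (hfg : Function.Exact f g) (hg : Function.Surjective g)
    (hF : IsWeaklyRegular F (rs ++ [a])) (hM : IsWeaklyRegular M rs) :
    IsWeaklyRegular K (rs ++ [a]) := by
  induction rs generalizing K F M with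
  | nil =>
    rw [List.nil_append, isWeaklyRegular_singleton_iff] at hF ⊢
    exact hF.of_injective f hf
  | cons r rs ih =>
    rw [List.cons_append, isWeaklyRegular_cons_iff] at hF ⊢
    rw [isWeaklyRegular_cons_iff] at hM
    exact ⟨hF.1.of_injective f hf, ih (injective_quotSMulTop_map hf hfg hM.1)
      (QuotSMulTop.map_exact r hfg hg) (QuotSMulTop.map_surjective r hg) hF.2 hM.2⟩

theorem isWeaklyRegular_ker {rs : List R} {a : R} (g : F →ₗ[R] M)
    (hF : IsWeaklyRegular F (rs ++ [a])) (hg : IsWeaklyRegular (LinearMap.range g) rs) :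
    IsWeaklyRegular (LinearMap.ker g) (rs ++ [a]) := by
  refine isWeaklyRegular_concat_of_exact (f := (LinearMap.ker g).subtype) (g := g.rangeRestrict)
    (LinearMap.ker g).injective_subtype ?_ g.surjective_rangeRestrict hF hg
  rw [LinearMap.exact_iff, LinearMap.ker_rangeRestrict, Submodule.range_subtype]

theorem mem_ofList_cons_smul_top_iff {r : R} {rs : List R} {x : M} :
    x ∈ (Ideal.ofList (r :: rs) • ⊤ : Submodule R M) ↔
      (Submodule.Quotient.mk x : QuotSMulTop r M) ∈
        (Ideal.ofList rs • ⊤ : Submodule R (QuotSMulTop r M)) := by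
  rw [Ideal.ofList_cons_smul, ← Submodule.comap_map_mkQ, Submodule.map_smul'', Submodule.map_top,
    Submodule.range_mkQ, Submodule.mem_comap, Submodule.mkQ_apply]

/-- This is the vanishing of `Tor₁(M, R/(rs))`. -/
theorem mem_ofList_smul_top_of_exact {rs : List R} {f : K →ₗ[R] F} {g : F →ₗ[R] M}
    (hf : Function.Injective f) (hfg : Function.Exact f g) (hg : Function.Surjective g)
    (hM : IsWeaklyRegular M rs) {x : K} (hx : f x ∈ (Ideal.ofList rs • ⊤ : Submodule R F)) :
    x ∈ (Ideal.ofList rs • ⊤ : Submodule R K) := by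
  induction rs generalizing K F M with
  | nil =>
    rw [Ideal.ofList_nil, Submodule.bot_smul, Submodule.mem_bot] at hx ⊢
    exact hf (hx.trans (map_zero f).symm)
  | cons r rs ih =>
    rw [isWeaklyRegular_cons_iff] at hM
    rw [mem_ofList_cons_smul_top_iff] at hx ⊢
    exact ih (injective_quotSMulTop_map hf hfg hM.1) (QuotSMulTop.map_exact r hfg hg)
      (QuotSMulTop.map_surjective r hg) hM.2 hx

theorem mem_ideal_smul_top_of_forall_mem {ι : Type*} [Finite ι] {I : Ideal R} {c : ι → R}
    (hc : ∀ i, c i ∈ I) : c ∈ (I • ⊤ : Submodule R (ι → R)) := by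
  classical
  have := Fintype.ofFinite ι
  rw [pi_eq_sum_univ' c]
  exact Submodule.sum_mem _ fun i _ => Submodule.smul_mem_smul (hc i) trivial

/-- If `rs` is regular on `M`, generators of `M` whose relations all have coefficients in the
ideal `(rs)` form a basis: their relation module `N` satisfies `N = (rs) N`. -/
theorem linearIndependent_of_isWeaklyRegular [IsDomain R] [IsNoetherianRing R] {rs : List R}
    (hrs : Ideal.ofList rs ≠ ⊤) (hM : IsWeaklyRegular M rs) {ι : Type*} [Fintype ι] {v : ι → M}
    (hspan : ⊤ ≤ Submodule.span R (Set.range v))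
    (hrel : ∀ c : ι → R, ∑ i, c i • v i = 0 → ∀ i, c i ∈ Ideal.ofList rs) :
    LinearIndependent R v := by
  rw [Fintype.linearIndependent_iff]
  set N := LinearMap.ker (Fintype.linearCombination R v)
  have hsurj : Function.Surjective (Fintype.linearCombination R v) := by
    rw [← LinearMap.range_eq_top, Fintype.range_linearCombination]
    exact top_le_iff.1 hspan
  have hle : N ≤ Ideal.ofList rs • N := by
    intro c hc
    rw [← Submodule.mem_smul_top_iff (Ideal.ofList rs) N ⟨c, hc⟩]
    refine mem_ofList_smul_top_of_exact N.injective_subtype ?_ hsurj hM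
      (mem_ideal_smul_top_of_forall_mem (hrel c hc))
    rw [LinearMap.exact_iff, Submodule.range_subtype]
  obtain ⟨r, hr, hrN⟩ := Submodule.exists_sub_one_mem_and_smul_eq_zero_of_fg_of_le_smul
    (Ideal.ofList rs) N (IsNoetherian.noetherian N) hle
  have hr0 : r ≠ 0 := by
    rintro rfl
    rw [zero_sub, neg_mem_iff, ← Ideal.eq_top_iff_one] at hr
    exact hrs hr
  intro c hc i
  exact (mul_eq_zero.1 (congrFun (hrN c hc) i)).resolve_left hr0

theorem isWeaklyRegular_pi {rs : List R} (h : IsWeaklyRegular R rs) (ι : Type*) [Finite ι] :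
    IsWeaklyRegular (ι → R) rs :=
  ((TensorProduct.rid R (ι → R)).isWeaklyRegular_congr rs).1 h.isWeaklyRegular_lTensor

variable {σ : Type*}

theorem ofList_map_X (l : List σ) :
    Ideal.ofList (l.map X) = Ideal.span (X '' {i | i ∈ l} : Set (MvPolynomial σ R)) :=
  congrArg Ideal.span (Set.ext fun _ => List.mem_map)

theorem isWeaklyRegular_map_X {l : List σ} (hl : l.Nodup) :
    IsWeaklyRegular (MvPolynomial σ R) (l.map X : List (MvPolynomial σ R)) := by
  induction l using List.reverseRecOn with
  | nil => exact IsWeaklyRegular.nil _ _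
  | append_singleton l a ih =>
    rw [List.nodup_append_comm, List.singleton_append, List.nodup_cons] at hl
    rw [List.map_append, List.map_singleton, isWeaklyRegular_append_iff,
      isWeaklyRegular_singleton_iff, isSMulRegular_quotient_iff_mem_of_smul_mem]
    refine ⟨ih hl.2, fun p hp => ?_⟩
    rw [smul_eq_mul, Ideal.mul_top, ofList_map_X, mem_ideal_span_X_image] at hp ⊢
    intro m hm
    obtain ⟨i, hil, hi⟩ := hp (Finsupp.single a 1 + m) (by
      rwa [mem_support_iff, smul_eq_mul, coeff_X_mul, ← mem_support_iff])
    have hai : a ≠ i := by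
      rintro rfl
      exact hl.1 hil
    rw [Finsupp.add_apply, Finsupp.single_eq_of_ne hai.symm, zero_add] at hi
    exact ⟨i, hil, hi⟩

/-- The kernel of `B` is a second syzygy module, so it has depth three: this is Hilbert's syzygy
theorem in three variables. -/
theorem isWeaklyRegular_ker_of_exact {ι κ : Type*} [Finite ι] [Finite κ] {i j k : σ}
    (hijk : [i, j, k].Nodup)
    {A : (κ → MvPolynomial σ R) →ₗ[MvPolynomial σ R] MvPolynomial σ R}
    {B : (ι → MvPolynomial σ R) →ₗ[MvPolynomial σ R] (κ → MvPolynomial σ R)}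
    (hBA : Function.Exact B A) :
    IsWeaklyRegular (LinearMap.ker B) ([i, j, k].map (X : σ → MvPolynomial σ R)) := by
  have hij : [i, j].Nodup := hijk.sublist (List.sublist_append_left [i, j] [k])
  have hrange : IsWeaklyRegular (LinearMap.range A) [(X i : MvPolynomial σ R)] :=
    (isWeaklyRegular_singleton_iff _ _).2 <|
      ((isWeaklyRegular_singleton_iff _ _).1
        (isWeaklyRegular_map_X (List.nodup_singleton i))).submodule _ _
  refine isWeaklyRegular_ker (rs := [X i, X j]) B
    (isWeaklyRegular_pi (isWeaklyRegular_map_X hijk) ι) ?_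
  rw [← hBA.linearMap_ker_eq]
  exact isWeaklyRegular_ker (rs := [X i]) A (isWeaklyRegular_pi (isWeaklyRegular_map_X hij) κ)
    hrange

end RegularSequence

/-! ### Minimal systems of homogeneous generators -/

section MinimalGenerators

theorem mem_span_image_compl_of_isUnit {R M ι : Type*} [Ring R] [AddCommGroup M] [Module R M]
    [Fintype ι] {v : ι → M} {c : ι → R} (hc : ∑ i, c i • v i = 0) {i₀ : ι} (hi₀ : IsUnit (c i₀)) :
    v i₀ ∈ Submodule.span R (v '' {i₀}ᶜ) := by
  classical
  rw [← Finset.add_sum_erase _ _ (Finset.mem_univ i₀)] at hc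
  obtain ⟨u, hu⟩ := hi₀
  have hrest : ∑ i ∈ Finset.univ.erase i₀, c i • v i ∈ Submodule.span R (v '' {i₀}ᶜ) :=
    Submodule.sum_mem _ fun i hi => Submodule.smul_mem _ _
      (Submodule.subset_span ⟨i, Finset.ne_of_mem_erase hi, rfl⟩)
  have hv : v i₀ = (↑u⁻¹ : R) • -∑ i ∈ Finset.univ.erase i₀, c i • v i := by
    rw [← eq_neg_of_add_eq_zero_left hc, ← hu, smul_smul, Units.inv_mul, one_smul]
  rw [hv]
  exact Submodule.smul_mem _ _ (Submodule.neg_mem _ hrest)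

theorem span_image_compl_eq_span_range_iff {R M ι : Type*} [Semiring R] [AddCommMonoid M]
    [Module R M] {v : ι → M} {i₀ : ι} :
    Submodule.span R (v '' {i₀}ᶜ) = Submodule.span R (Set.range v) ↔
      v i₀ ∈ Submodule.span R (v '' {i₀}ᶜ) := by
  refine ⟨fun h => h ▸ Submodule.subset_span (Set.mem_range_self i₀), fun h => ?_⟩
  rw [← Submodule.span_insert_eq_span h, ← Set.image_insert_eq, ← Set.union_singleton,
    Set.compl_union_self, Set.image_univ]

theorem exists_finset_minimal_span_eq {R M : Type*} [Semiring R] [AddCommMonoid M] [Module R M]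
    {H : Set M} (hH : (Submodule.span R H).FG) :
    ∃ T : Finset M, ↑T ⊆ H ∧ Submodule.span R (T : Set M) = Submodule.span R H ∧
      ∀ v ∈ T, v ∉ Submodule.span R ((T : Set M) \ {v}) := by
  classical
  obtain ⟨T₀, hT₀H, hT₀⟩ := (Submodule.fg_span_iff_fg_span_finset_subset H).1 hH
  obtain ⟨T, ⟨hTH, hT⟩, hmin⟩ := exists_minimal_of_wellFoundedLT
    (fun T : Finset M => ↑T ⊆ H ∧ Submodule.span R (T : Set M) = Submodule.span R H)
    ⟨T₀, hT₀H, hT₀.symm⟩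
  refine ⟨T, hTH, hT, fun v hv hspan => ?_⟩
  have herase : Submodule.span R ((T.erase v : Finset M) : Set M) = Submodule.span R H := by
    rw [Finset.coe_erase, ← Submodule.span_insert_eq_span hspan, Set.insert_sdiff_singleton,
      Set.insert_eq_of_mem (Finset.mem_coe.2 hv), hT]
  exact Finset.notMem_erase v T
    (hmin ⟨(Finset.coe_subset.2 (T.erase_subset v)).trans hTH, herase⟩ (T.erase_subset v) hv)

theorem exists_monotone_comp_of_finset {α β : Type*} [LinearOrder β] (T : Finset α) (d : α → β) :
    ∃ v : Fin T.card → α, Function.Injective v ∧ Set.range v = T ∧ Monotone (d ∘ v) := by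
  set v₀ : Fin T.card → α := fun i => T.equivFin.symm i
  refine ⟨v₀ ∘ Tuple.sort (d ∘ v₀), ?_, ?_, Tuple.monotone_sort (d ∘ v₀)⟩
  · exact (Subtype.val_injective.comp T.equivFin.symm.injective).comp (Equiv.injective _)
  · rw [(Equiv.surjective _).range_comp]
    exact (T.equivFin.symm.surjective.range_comp _).trans Subtype.range_coe

theorem eventually_sum_degreeComponent_sub {σ R : Type*} [CommRing R] (p : MvPolynomial σ R)
    (c : ℤ) : ∀ᶠ T : Finset ℤ in Filter.atTop, ∑ k ∈ T, degreeComponent (k - c) p = p := by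
  filter_upwards [Filter.eventually_ge_atTop
    ((Finset.range (p.totalDegree + 1)).image fun n : ℕ => n + c)] with T hT
  rw [← Finset.sum_subset hT, Finset.sum_image fun a _ b _ hab => by simpa using hab]
  · simp only [add_sub_cancel_right, degreeComponent_natCast, sum_homogeneousComponent]
  · intro k _ hk
    rcases lt_or_ge (k - c) 0 with hneg | hpos
    · rw [degreeComponent_of_neg hneg, LinearMap.zero_apply]
    · obtain ⟨n, hn⟩ := Int.eq_ofNat_of_zero_le hpos
      rw [hn, degreeComponent_natCast]
      refine homogeneousComponent_eq_zero _ _ (not_le.1 fun hle => hk ?_)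
      exact Finset.mem_image.2 ⟨n, Finset.mem_range.2 (Nat.lt_succ_of_le hle), by omega⟩

theorem mem_span_range_freeComponent {σ R ι : Type*} [CommRing R] [Finite ι] (e : ι → ℤ)
    (v : ι → MvPolynomial σ R) :
    v ∈ Submodule.span (MvPolynomial σ R) (Set.range fun k => freeComponent e k v) := by
  obtain ⟨T, hT⟩ := (Filter.eventually_all.2 fun i =>
    eventually_sum_degreeComponent_sub (v i) (e i)).exists
  have hsum : ∑ k ∈ T, freeComponent e k v = v := funext fun i => by
    rw [Finset.sum_apply]
    exact hT i
  have hmem := Submodule.sum_mem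
    (Submodule.span (MvPolynomial σ R) (Set.range fun k => freeComponent e k v))
    fun k (_ : k ∈ T) => Submodule.subset_span (Set.mem_range_self k)
  rwa [hsum] at hmem

theorem exists_minimal_homogeneous_generators {σ K ι : Type*} [Finite σ] [CommRing K]
    [IsNoetherianRing K] [Finite ι] {e : ι → ℤ}
    {N : Submodule (MvPolynomial σ K) (ι → MvPolynomial σ K)}
    (hN : ∀ v ∈ N, ∀ k, freeComponent e k v ∈ N) :
    ∃ (s : ℕ) (n : Fin s → ℤ) (A : Fin s → ι → MvPolynomial σ K), Monotone n ∧
      IsHomogeneousMatrix n e A ∧ Submodule.span (MvPolynomial σ K) (Set.range A) = N ∧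
      ∀ i, A i ∉ Submodule.span (MvPolynomial σ K) (A '' {i}ᶜ) := by
  set H : Set (ι → MvPolynomial σ K) := {v | v ∈ N ∧ ∃ k, ∀ j, v j ∈ degreePart σ K (k - e j)}
  have hspan : Submodule.span (MvPolynomial σ K) H = N := by
    refine le_antisymm (Submodule.span_le.2 fun v hv => hv.1) fun v hv => ?_
    refine Submodule.span_mono ?_ (mem_span_range_freeComponent e v)
    rintro _ ⟨k, rfl⟩
    exact ⟨hN v hv k, k, fun j => degreeComponent_mem _ _⟩
  obtain ⟨T, hTH, hT, hmin⟩ := exists_finset_minimal_span_eq (IsNoetherian.noetherian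
    (Submodule.span (MvPolynomial σ K) H))
  choose! d hd using fun v (hv : v ∈ H) => hv.2
  obtain ⟨A, hinj, hrange, hmono⟩ := exists_monotone_comp_of_finset T d
  have hAT : ∀ i, A i ∈ T := fun i => by
    rw [← Finset.mem_coe, ← hrange]
    exact Set.mem_range_self i
  refine ⟨T.card, d ∘ A, A, hmono, fun i => hd _ (hTH (hAT i)), by rw [hrange, hT, hspan],
    fun i => ?_⟩
  rw [Set.image_compl_eq_range_sdiff_image hinj, hrange, Set.image_singleton]
  exact hmin _ (hAT i)

theorem mem_span_image_compl_of_constantCoeff_ne_zero {σ K ι η : Type*} [Field K] [Fintype η]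
    {n : η → ℤ} {e : ι → ℤ} {A : η → ι → MvPolynomial σ K} (hA : IsHomogeneousMatrix n e A)
    {a : η → MvPolynomial σ K} (ha : ∑ i, a i • A i = 0) {i₀ : η}
    (hi₀ : constantCoeff (a i₀) ≠ 0) :
    A i₀ ∈ Submodule.span (MvPolynomial σ K) (A '' {i₀}ᶜ) := by
  have hrel : ∑ i, freeComponent n (n i₀) a i • A i = 0 := by
    rw [← Fintype.linearCombination_apply, ← freeComponent_linearCombination hA,
      Fintype.linearCombination_apply, ha, map_zero]
  refine mem_span_image_compl_of_isUnit hrel ?_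
  rw [freeComponent_apply, sub_self, ← Nat.cast_zero, degreeComponent_natCast,
    homogeneousComponent_zero, ← constantCoeff_eq]
  exact (isUnit_iff_ne_zero.2 hi₀).map C

end MinimalGenerators

/-! ### Coprime forms in the Jacobian ideal -/

section Pderiv

variable {σ R : Type*} [CommRing R]

theorem totalDegree_pderiv_lt {p : MvPolynomial σ R} {i : σ} (h : pderiv i p ≠ 0) :
    (pderiv i p).totalDegree < p.totalDegree := by
  obtain ⟨m, hm, hdeg⟩ := Finset.exists_mem_eq_sup _ (support_nonempty.2 h)
    fun s : σ →₀ ℕ => s.degree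
  have hsupport : m + Finsupp.single i 1 ∈ p.support := by
    rw [mem_support_iff] at hm ⊢
    rw [coeff_pderiv] at hm
    exact left_ne_zero_of_mul hm
  calc (pderiv i p).totalDegree = m.degree := hdeg
    _ < (m + Finsupp.single i 1).degree := by simp
    _ ≤ p.totalDegree := le_totalDegree hsupport

variable [IsDomain R]

theorem pderiv_eq_zero_of_dvd {p : MvPolynomial σ R} {i : σ} (h : p ∣ pderiv i p) :
    pderiv i p = 0 := by
  by_contra hne
  exact (totalDegree_pderiv_lt hne).not_ge (totalDegree_le_of_dvd_of_isDomain h hne)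

theorem eq_C_of_forall_pderiv_eq_zero [CharZero R] {p : MvPolynomial σ R}
    (h : ∀ i, pderiv i p = 0) : p = C (coeff 0 p) := by
  classical
  ext m
  rw [coeff_C]
  split_ifs with hm
  · rw [hm]
  · obtain ⟨i, hi⟩ := Finsupp.ne_iff.1 (Ne.symm hm)
    have hle : Finsupp.single i 1 ≤ m := by simpa [Nat.one_le_iff_ne_zero] using hi
    have hcoeff : coeff (m - Finsupp.single i 1) (pderiv i p) = 0 := by rw [h i, coeff_zero]
    rw [coeff_pderiv, tsub_add_cancel_of_le hle] at hcoeff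
    exact (mul_eq_zero.1 hcoeff).resolve_right (Nat.cast_add_one_ne_zero _)

variable {K : Type*} [Field K] [CharZero K]

theorem exists_pderiv_ne_zero_of_prime {p : MvPolynomial σ K} (hp : Prime p) :
    ∃ i, pderiv i p ≠ 0 := by
  by_contra! h
  have hC := eq_C_of_forall_pderiv_eq_zero h
  refine hp.not_isUnit (hC ▸ (isUnit_iff_ne_zero.2 fun h0 => hp.ne_zero ?_).map C)
  rw [hC, h0, map_zero]

theorem exists_not_dvd_pderiv_of_squarefree {p f : MvPolynomial σ K} (hf : Squarefree f)
    (hp : Prime p) (hpf : p ∣ f) : ∃ i, ¬ p ∣ pderiv i f := by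
  obtain ⟨g, rfl⟩ := hpf
  have hpg : ¬ p ∣ g := fun hg => hp.not_isUnit (hf p (mul_dvd_mul_left p hg))
  obtain ⟨i, hi⟩ := exists_pderiv_ne_zero_of_prime hp
  refine ⟨i, fun hdvd => hi (pderiv_eq_zero_of_dvd ?_)⟩
  rw [pderiv_mul, dvd_add_left (dvd_mul_right p _)] at hdvd
  exact (hp.dvd_or_dvd hdvd).resolve_right hpg

theorem exists_not_dvd_pderiv_of_isHomogeneous [Finite σ] {p f : MvPolynomial σ K} {d : ℕ}
    (hd : d ≠ 0) (hhom : f.IsHomogeneous d) (hf : Squarefree f) (hp : Prime p) :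
    ∃ i, ¬ p ∣ pderiv i f := by
  have := Fintype.ofFinite σ
  by_contra! h
  have hEuler : p ∣ C (d : K) * f := by
    rw [map_natCast, ← nsmul_eq_mul, ← hhom.sum_X_mul_pderiv]
    exact Finset.dvd_sum fun i _ => (h i).mul_left _
  have hunit : IsUnit (C (d : K) : MvPolynomial σ K) :=
    (isUnit_iff_ne_zero.2 (Nat.cast_ne_zero.2 hd)).map C
  obtain ⟨i, hi⟩ := exists_not_dvd_pderiv_of_squarefree hf hp (hunit.dvd_mul_left.1 hEuler)
  exact hi (h i)

end Pderiv

section Coprime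

/-- Two of the infinitely many elements `b + t • c` would share a prime factor of `a`. -/
theorem exists_isRelPrime_add_smul {K R : Type*} [Field K] [Infinite K] [CommRing R] [IsDomain R]
    [UniqueFactorizationMonoid R] [Algebra K R] {a b c : R} (ha : a ≠ 0)
    (h : ∀ p, Prime p → p ∣ a → p ∣ b → ¬ p ∣ c) : ∃ t : K, IsRelPrime a (b + t • c) := by
  classical
  by_contra! hcon
  have hfactor : ∀ t : K, ∃ p : (UniqueFactorizationMonoid.factors a).toFinset,
      (p : R) ∣ b + t • c := fun t => by
    have ht := hcon t
    rw [UniqueFactorizationMonoid.isRelPrime_iff_no_prime_factors ha] at ht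
    push Not at ht
    obtain ⟨p, hpa, hpb, hp⟩ := ht
    obtain ⟨q, hq, hpq⟩ := UniqueFactorizationMonoid.exists_mem_factors_of_dvd ha
      hp.irreducible hpa
    exact ⟨⟨q, Multiset.mem_toFinset.2 hq⟩, hpq.symm.dvd.trans hpb⟩
  choose p hp using hfactor
  obtain ⟨s, t, hst, hpst⟩ := Finite.exists_ne_map_eq_of_infinite p
  have hmem : (p t : R) ∈ UniqueFactorizationMonoid.factors a := Multiset.mem_toFinset.1 (p t).2
  have hc : (p t : R) ∣ c := by
    have hsub := dvd_sub (hpst ▸ hp s) (hp t)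
    rw [add_sub_add_left_eq_sub, ← sub_smul] at hsub
    simpa only [inv_smul_smul₀ (sub_ne_zero.2 hst)] using
      dvd_smul_of_dvd (s - t)⁻¹ hsub
  have hb : (p t : R) ∣ b := (dvd_add_left (dvd_smul_of_dvd t hc)).1 (hp t)
  exact h _ (UniqueFactorizationMonoid.prime_of_factor _ hmem)
    (UniqueFactorizationMonoid.dvd_of_mem_factors hmem) hb hc

variable {R : Type*} [CommRing R] [IsDomain R]

theorem exact_koszul_pair [DecompositionMonoid R] {g h : R} (hg : g ≠ 0) (hgh : IsRelPrime g h) :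
    Function.Exact (Fintype.linearCombination R ![![h, -g]])
      (Fintype.linearCombination R ![g, h]) := by
  intro v
  simp only [Fintype.linearCombination_apply, Fin.sum_univ_two, Fin.sum_univ_one, smul_eq_mul,
    Set.mem_range, Matrix.cons_val_zero, Matrix.cons_val_one]
  constructor
  · intro hv
    obtain ⟨u, hu⟩ : g ∣ v 1 := hgh.dvd_of_dvd_mul_right ⟨-v 0, by linear_combination hv⟩
    have hv₀ : v 0 = -u * h := mul_right_cancel₀ hg (by linear_combination hv - h * hu)
    refine ⟨fun _ => -u, funext fun i => ?_⟩
    fin_cases i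
    · simp [hv₀]
    · simp [hu, mul_comm]
  · rintro ⟨w, rfl⟩
    simp only [Pi.smul_apply, Matrix.cons_val_zero, Matrix.cons_val_one, smul_eq_mul]
    ring

theorem injective_koszul_pair {g : R} (hg : g ≠ 0) (h : R) :
    Function.Injective (Fintype.linearCombination R ![![h, -g]]) := by
  refine (linearIndependent_unique_iff.2 fun hzero => hg ?_).fintypeLinearCombination_injective
  simpa using congrFun hzero 1

end Coprime

theorem hilbertFunction_span_pair {g h : PolyS} {a b : ℕ} (hg₀ : g ≠ 0) (hgh : IsRelPrime g h)
    (hg : g.IsHomogeneous a) (hh : h.IsHomogeneous b) {k : ℕ} (hk : a + b ≤ k) :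
    hilbertFunction (Ideal.span (Set.range ![g, h])) k = a * b := by
  have hdeg : ∀ i, ![g, h] i ∈ degreePart (Fin 3) ℂ (![(a : ℤ), b] i) := by
    simp [Fin.forall_fin_two, degreePart_natCast, hg, hh]
  have hkoszul : IsHomogeneousMatrix ![(a : ℤ) + b] ![(a : ℤ), b] ![![h, -g]] := by
    simp [IsHomogeneousMatrix, Fin.forall_fin_two, degreePart_natCast, hg, hh]
  have hrank : ∀ n : ℤ, 0 ≤ n →
      2 * (Module.finrank ℂ (degreePart (Fin 3) ℂ n) : ℤ) = (n + 1) * (n + 2) :=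
    fun _ => two_mul_finrank_degreePart
  have hquot := hilbertFunction_add_finrank_gradedImage hdeg k
  have hsyz : Module.finrank ℂ (gradedImage ![(a : ℤ), b] k
        (Fintype.linearCombination PolyS ![g, h])) +
      Module.finrank ℂ (degreePart (Fin 3) ℂ (k - (a + b))) =
      Module.finrank ℂ (degreePart (Fin 3) ℂ (k - a)) +
        Module.finrank ℂ (degreePart (Fin 3) ℂ (k - b)) := by
    have hadd := finrank_gradedImage_add hkoszul (exact_koszul_pair hg₀ hgh) k
    rwa [finrank_gradedImage_of_injective (injective_koszul_pair hg₀ h), Fin.sum_univ_one,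
      Fin.sum_univ_two] at hadd
  zify at hquot hsyz ⊢
  refine mul_left_cancel₀ (two_ne_zero (α := ℤ)) ?_
  linear_combination 2 * hquot - 2 * hsyz + hrank k (by omega) - hrank (k - a) (by omega) -
    hrank (k - b) (by omega) + hrank (k - (a + b)) (by omega)

theorem hilbertFunction_anti {I J : Ideal PolyS} (hIJ : I ≤ J) (k : ℕ) :
    hilbertFunction J k ≤ hilbertFunction I k := by
  have hfactor : (Ideal.Quotient.mkₐ ℂ J).toLinearMap =
      (Ideal.Quotient.factorₐ ℂ hIJ).toLinearMap ∘ₗ (Ideal.Quotient.mkₐ ℂ I).toLinearMap := rfl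
  have : Module.Finite ℂ (homogeneousSubmodule (Fin 3) ℂ k) :=
    degreePart_natCast (σ := Fin 3) (R := ℂ) k ▸ finite_degreePart k
  rw [hilbertFunction, hfactor, Submodule.map_comp]
  exact Submodule.finrank_map_le _ _

namespace IsReducedPlaneCurve

variable {d : ℕ} {f : PolyS}

theorem exists_not_dvd_pderiv (hf : IsReducedPlaneCurve d f) {p : PolyS} (hp : Prime p) :
    ∃ i, ¬ p ∣ pderiv i f :=
  exists_not_dvd_pderiv_of_isHomogeneous (by have := hf.three_le; omega) hf.isHomogeneous
    hf.squarefree hp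

theorem exists_pderiv_ne_zero (hf : IsReducedPlaneCurve d f) : ∃ i, pderiv i f ≠ 0 := by
  obtain ⟨i, hi⟩ := hf.exists_not_dvd_pderiv (X_prime (i := 0))
  exact ⟨i, fun h => hi (h ▸ dvd_zero _)⟩

theorem exists_isRelPrime_mem_jacobianIdeal (hf : IsReducedPlaneCurve d f) :
    ∃ g h : PolyS, g ≠ 0 ∧ IsRelPrime g h ∧ g.IsHomogeneous (d - 1) ∧ h.IsHomogeneous (d - 1) ∧
      g ∈ jacobianIdeal f ∧ h ∈ jacobianIdeal f := by
  obtain ⟨i, hi⟩ := hf.exists_pderiv_ne_zero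
  have hmem : ∀ j, pderiv j f ∈ jacobianIdeal f := fun j => Ideal.subset_span ⟨j, rfl⟩
  have hcyclic : ∀ i l : Fin 3, l = i ∨ l = i + 1 ∨ l = i + 2 := by decide
  obtain ⟨t, ht⟩ := exists_isRelPrime_add_smul (K := ℂ) (b := pderiv (i + 1) f)
    (c := pderiv (i + 2) f) hi fun p hp h₀ h₁ h₂ => by
      obtain ⟨l, hl⟩ := hf.exists_not_dvd_pderiv hp
      rcases hcyclic i l with rfl | rfl | rfl
      exacts [hl h₀, hl h₁, hl h₂]
  have hhom : ∀ j, (pderiv j f).IsHomogeneous (d - 1) := fun j => hf.isHomogeneous.pderiv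
  rw [smul_eq_C_mul] at ht
  exact ⟨pderiv i f, _, hi, ht, hhom i, (hhom _).add ((hhom _).C_mul t), hmem i,
    add_mem (hmem _) (Ideal.mul_mem_left _ _ (hmem _))⟩

theorem hilbertFunction_jacobianIdeal_le (hf : IsReducedPlaneCurve d f) {k : ℕ}
    (hk : 2 * (d - 1) ≤ k) : hilbertFunction (jacobianIdeal f) k ≤ (d - 1) ^ 2 := by
  obtain ⟨g, h, hg₀, hgh, hg, hh, hgJ, hhJ⟩ := hf.exists_isRelPrime_mem_jacobianIdeal
  rw [sq, ← hilbertFunction_span_pair hg₀ hgh hg hh (two_mul (d - 1) ▸ hk)]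
  refine hilbertFunction_anti (Ideal.span_le.2 ?_) k
  rintro _ ⟨i, rfl⟩
  fin_cases i
  exacts [hgJ, hhJ]

end IsReducedPlaneCurve

/-! ### Minimal resolutions -/

section Resolution

theorem finrank_range_add_finrank_ker_pi {R M ι : Type*} [CommRing R] [IsDomain R]
    [AddCommGroup M] [Module R M] [Fintype ι] (A : (ι → R) →ₗ[R] M) :
    Module.finrank R (LinearMap.range A) + Module.finrank R (LinearMap.ker A) =
      Fintype.card ι := by
  rw [← A.quotKerEquivRange.finrank_eq, Submodule.finrank_quotient_add_finrank,
    Module.finrank_fintype_fun_eq_card]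

theorem finrank_ker_pi_add_one {R ι : Type*} [CommRing R] [IsDomain R] [Fintype ι]
    {B : (ι → R) →ₗ[R] R} (hB : B ≠ 0) :
    Module.finrank R (LinearMap.ker B) + 1 = Fintype.card ι := by
  have : Nontrivial (LinearMap.range B) :=
    Submodule.nontrivial_iff_ne_bot.2 (mt LinearMap.range_eq_bot.1 hB)
  have hle : Module.finrank R (LinearMap.range B) ≤ 1 :=
    (Submodule.finrank_le _).trans_eq (Module.finrank_self R)
  have hpos : 0 < Module.finrank R (LinearMap.range B) := Module.finrank_pos
  rw [← finrank_range_add_finrank_ker_pi B]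
  omega

variable {K ι κ : Type*} [Field K]

theorem isHomogeneousMatrix_of_isHomogeneous {σ : Type*} {n : ι → ℕ}
    {A : ι → κ → MvPolynomial σ K} (hA : ∀ i j, (A i j).IsHomogeneous (n i)) (a : ℤ) :
    IsHomogeneousMatrix (fun i => a + n i) (fun _ => a) A := fun i j => by
  rw [add_sub_cancel_left, degreePart_natCast]
  exact hA i j

theorem pos_of_mem_degreePart {σ : Type*} {a : ℤ} {p : MvPolynomial σ K}
    (hp : p ∈ degreePart σ K a) (hp₀ : p ≠ 0) (hconst : constantCoeff p = 0) : 0 < a := by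
  obtain ⟨n, rfl, hn⟩ := (mem_degreePart_iff.1 hp).resolve_left hp₀
  refine Int.natCast_pos.2 (Nat.pos_of_ne_zero ?_)
  rintro rfl
  rw [← totalDegree_zero_iff_isHomogeneous, totalDegree_eq_zero_iff_eq_C, ← constantCoeff_eq,
    hconst, map_zero] at hn
  exact hp₀ hn

theorem exists_lt_of_isHomogeneousMatrix {σ η : Type*} {n : η → ℤ} {e : ι → ℤ}
    {A : η → ι → MvPolynomial σ K} (hA : IsHomogeneousMatrix n e A) {i : η} (hi : A i ≠ 0)
    (hconst : ∀ j, constantCoeff (A i j) = 0) : ∃ j, e j < n i := by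
  obtain ⟨j, hj⟩ := Function.ne_iff.1 hi
  exact ⟨j, sub_pos.1 (pos_of_mem_degreePart (hA i j) hj (hconst j))⟩

theorem mem_ofList_map_X_iff {σ R : Type*} [CommRing R] {l : List σ} (hl : ∀ i, i ∈ l)
    {p : MvPolynomial σ R} : p ∈ Ideal.ofList (l.map X) ↔ constantCoeff p = 0 := by
  simp only [ofList_map_X, hl, Set.ofPred_true, mem_ideal_span_X_image, mem_support_iff,
    Set.mem_univ, true_and, constantCoeff_eq]
  refine ⟨fun h => by_contra fun h₀ => (h 0 h₀).elim fun i hi => hi rfl, fun h m hm => ?_⟩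
  have hm₀ : m ≠ 0 := fun hm₀ => hm (hm₀ ▸ h)
  exact Finsupp.ne_iff.1 hm₀

variable [Fintype ι] [Finite κ] {e : ι → ℤ} {c : κ → ℤ}

theorem linearIndependent_of_span_eq_ker
    {A : ι → κ → MvPolynomial (Fin 3) K}
    {B : (κ → MvPolynomial (Fin 3) K) →ₗ[MvPolynomial (Fin 3) K] MvPolynomial (Fin 3) K}
    (hAB : Function.Exact (Fintype.linearCombination (MvPolynomial (Fin 3) K) A) B)
    {η : Type*} [Finite η] {n : η → ℤ} {T : η → ι → MvPolynomial (Fin 3) K}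
    (hT : IsHomogeneousMatrix n e T)
    (hspan : Submodule.span (MvPolynomial (Fin 3) K) (Set.range T) =
      LinearMap.ker (Fintype.linearCombination (MvPolynomial (Fin 3) K) A))
    (hmin : ∀ i, T i ∉ Submodule.span (MvPolynomial (Fin 3) K) (T '' {i}ᶜ)) :
    LinearIndependent (MvPolynomial (Fin 3) K) T := by
  have := Fintype.ofFinite η
  have hvars : ∀ i : Fin 3, i ∈ [(0 : Fin 3), 1, 2] := by decide
  set N := LinearMap.ker (Fintype.linearCombination (MvPolynomial (Fin 3) K) A)
  have hTN : ∀ i, T i ∈ N := fun i => hspan ▸ Submodule.subset_span (Set.mem_range_self i)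
  suffices LinearIndependent (MvPolynomial (Fin 3) K) fun i => (⟨T i, hTN i⟩ : N) from
    this.map' N.subtype N.ker_subtype
  refine linearIndependent_of_isWeaklyRegular ?_
    (isWeaklyRegular_ker_of_exact (i := 0) (j := 1) (k := 2) (by decide) hAB) ?_ fun a ha i => ?_
  · rw [Ideal.ne_top_iff_one, mem_ofList_map_X_iff hvars, map_one]
    exact one_ne_zero
  · exact ((Submodule.span_range_subtype_eq_top_iff N hTN).2 hspan).ge
  · rw [mem_ofList_map_X_iff hvars]
    by_contra hi
    refine hmin i (mem_span_image_compl_of_constantCoeff_ne_zero hT (a := a) ?_ hi)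
    simpa using congrArg N.subtype ha

theorem exists_minimal_free_ker {A : ι → κ → MvPolynomial (Fin 3) K}
    (hA : IsHomogeneousMatrix e c A)
    {B : (κ → MvPolynomial (Fin 3) K) →ₗ[MvPolynomial (Fin 3) K] MvPolynomial (Fin 3) K}
    (hAB : Function.Exact (Fintype.linearCombination (MvPolynomial (Fin 3) K) A) B)
    (hmin : ∀ i, A i ∉ Submodule.span (MvPolynomial (Fin 3) K) (A '' {i}ᶜ)) :
    ∃ (s : ℕ) (n : Fin s → ℤ) (T : Fin s → ι → MvPolynomial (Fin 3) K), Monotone n ∧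
      IsHomogeneousMatrix n e T ∧ LinearIndependent (MvPolynomial (Fin 3) K) T ∧
      Function.Exact (Fintype.linearCombination (MvPolynomial (Fin 3) K) T)
        (Fintype.linearCombination (MvPolynomial (Fin 3) K) A) ∧
      ∀ i j, constantCoeff (T i j) = 0 := by
  obtain ⟨s, n, T, hmono, hT, hspan, hTmin⟩ := exists_minimal_homogeneous_generators (e := e)
    (N := LinearMap.ker (Fintype.linearCombination (MvPolynomial (Fin 3) K) A)) fun v hv k => by
      rw [LinearMap.mem_ker] at hv ⊢
      rw [← freeComponent_linearCombination hA, hv, map_zero]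
  refine ⟨s, n, T, hmono, hT, linearIndependent_of_span_eq_ker hAB hT hspan hTmin,
    LinearMap.exact_iff.2 (by rw [Fintype.range_linearCombination, hspan]), fun i j => ?_⟩
  by_contra hij
  have hTi : T i ∈ LinearMap.ker (Fintype.linearCombination (MvPolynomial (Fin 3) K) A) :=
    hspan ▸ Submodule.subset_span (Set.mem_range_self i)
  exact hmin j (mem_span_image_compl_of_constantCoeff_ne_zero hA hTi hij)

end Resolution

namespace IsReducedPlaneCurve

variable {d m : ℕ} {f : PolyS} {dd : Fin m → ℕ} {ρ : Fin m → Fin 3 → PolyS}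

theorem finrank_jacobianSyzygies (hf : IsReducedPlaneCurve d f) :
    Module.finrank PolyS (jacobianSyzygies f) = 2 := by
  obtain ⟨i, hi⟩ := hf.exists_pderiv_ne_zero
  have hne : jacobianMap f ≠ 0 := fun h => hi <| by
    simpa [jacobianMap] using LinearMap.congr_fun h (Pi.single i 1)
  exact Nat.succ_injective (finrank_ker_pi_add_one hne)

theorem exists_isMinimalMilnorResolution (hf : IsReducedPlaneCurve d f)
    (hρ : IsMinimalSyzygyGenerators f dd ρ) (hdd : ∀ j, dd j ≠ 0) :
    ∃ (e : Fin (m - 2) → ℕ) (σ : Fin (m - 2) → Fin m → PolyS),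
      IsMinimalMilnorResolution f d dd e ρ σ := by
  have hd := hf.three_le
  have hexact : Function.Exact (Fintype.linearCombination PolyS ρ) (jacobianMap f) :=
    LinearMap.exact_iff.2 ((Fintype.range_linearCombination PolyS ρ).trans hρ.span_eq).symm
  obtain ⟨s, e, σ, hmono, hσ, hindep, hexact', hconst⟩ := exists_minimal_free_ker
    (isHomogeneousMatrix_of_isHomogeneous hρ.isHomogeneous ((d : ℤ) - 1)) hexact fun j hj =>
      hρ.minimal j ((span_image_compl_eq_span_range_iff.2 hj).trans hρ.span_eq)
  obtain rfl : s = m - 2 := by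
    have hrank := finrank_range_add_finrank_ker_pi (Fintype.linearCombination PolyS ρ)
    rw [hexact'.linearMap_ker_eq, ← hexact.linearMap_ker_eq, Fintype.range_linearCombination,
      finrank_span_eq_card hindep] at hrank
    have := hf.finrank_jacobianSyzygies
    simp only [Fintype.card_fin] at hrank
    rw [← jacobianSyzygies] at hrank
    omega
  lift e to Fin (m - 2) → ℕ using fun i => by
    obtain ⟨j, hj⟩ := exists_lt_of_isHomogeneousMatrix hσ (hindep.ne_zero i) (hconst i)
    omega
  have hconst_of_ne : ∀ {p : PolyS} {n : ℕ}, p.IsHomogeneous n → n ≠ 0 → constantCoeff p = 0 :=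
    fun hp hn => hp.coeff_eq_zero (by simpa using hn.symm)
  exact ⟨e, σ, hρ.monotone, fun i j hij => Int.ofNat_le.1 (hmono hij), hρ.isHomogeneous,
    fun i j => mem_degreePart_iff.1 (by simpa only [sub_sub] using hσ i j),
    hindep.fintypeLinearCombination_injective, hexact', hexact,
    fun i => hconst_of_ne hf.isHomogeneous.pderiv (by omega),
    fun j i => hconst_of_ne (hρ.isHomogeneous j i) (hdd j), hconst⟩

end IsReducedPlaneCurve

/-! ### Degrees in a minimal resolution -/

theorem eq_zero_of_forall_abs_mul_add_le {α β B : ℤ} {N : ℕ}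
    (h : ∀ k : ℕ, N ≤ k → |α * k + β| ≤ B) : α = 0 := by
  have h₁ := abs_le.1 (h N le_rfl)
  have h₂ := abs_le.1 (h (N + (2 * B.toNat + 1)) (Nat.le_add_right _ _))
  have hB : (B.toNat : ℤ) = B := Int.toNat_of_nonneg ((abs_nonneg _).trans (h N le_rfl))
  push_cast [hB] at h₂
  have hle : |α| * (2 * B + 1) ≤ 2 * B := by
    rw [← abs_of_nonneg (show 0 ≤ 2 * B + 1 by linarith), ← abs_mul, abs_le]
    constructor <;> linarith
  exact abs_eq_zero.1 (by nlinarith [abs_nonneg α, Int.one_le_abs (z := α)])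

theorem pos_last_of_monotone_of_sum_pos {n : ℕ} {x : Fin (n + 1) → ℤ} (hx : Monotone x)
    (hsum : 0 < ∑ j, x j) : 0 < x (Fin.last n) := by
  obtain ⟨j, -, hj⟩ := Finset.exists_lt_of_sum_lt (f := 0) (hsum.trans_eq' (by simp))
  exact hj.trans_le (hx (Fin.le_last j))

theorem eq_ite_of_monotone_of_sum_eq_one {q : ℕ} {x : Fin q → ℤ} (hx : Monotone x)
    (hx₀ : ∀ j, 0 ≤ x j) (hsum : ∑ j, x j = 1) (j : Fin q) :
    x j = if (j : ℕ) + 1 = q then 1 else 0 := by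
  obtain _ | n := q
  · exact j.elim0
  have hlast := pos_last_of_monotone_of_sum_pos hx (hsum ▸ one_pos)
  have hinit : 0 ≤ ∑ i : Fin n, x i.castSucc := Finset.sum_nonneg fun _ _ => hx₀ _
  rw [Fin.sum_univ_castSucc] at hsum
  have hzero := (Finset.sum_eq_zero_iff_of_nonneg fun i _ => hx₀ (Fin.castSucc i)).1
    (show ∑ i : Fin n, x i.castSucc = 0 by omega)
  cases j using Fin.lastCases with
  | last => rw [if_pos (by simp)]; omega
  | cast i => rw [hzero i (Finset.mem_univ i), if_neg (by simp [i.2.ne])]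

theorem eq_ite_of_monotone_of_sum_eq_two {q : ℕ} {x : Fin q → ℤ} (hx : Monotone x)
    (hx₀ : ∀ j, 0 ≤ x j) (hsum : ∑ j, x j = 2) :
    (∀ j : Fin q, x j = if (j : ℕ) + 1 = q then 2 else 0) ∨
      ∀ j : Fin q, x j = if (j : ℕ) + 1 = q ∨ (j : ℕ) + 1 = q - 1 then 1 else 0 := by
  obtain _ | n := q
  · exact Or.inl fun j => j.elim0
  have hlast := pos_last_of_monotone_of_sum_pos hx (hsum ▸ two_pos)
  have hinit : 0 ≤ ∑ i : Fin n, x i.castSucc := Finset.sum_nonneg fun _ _ => hx₀ _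
  rw [Fin.sum_univ_castSucc] at hsum
  obtain hone | htwo : x (Fin.last n) = 1 ∨ x (Fin.last n) = 2 := by omega
  · right
    have hinit_eq := eq_ite_of_monotone_of_sum_eq_one (hx.comp Fin.strictMono_castSucc.monotone)
      (fun i => hx₀ i.castSucc) (show ∑ i : Fin n, x i.castSucc = 1 by omega)
    intro j
    cases j using Fin.lastCases with
    | last => rw [hone, if_pos (by simp)]
    | cast i => simpa [i.2.ne] using hinit_eq i
  · left
    have hzero := (Finset.sum_eq_zero_iff_of_nonneg fun i _ => hx₀ (Fin.castSucc i)).1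
      (show ∑ i : Fin n, x i.castSucc = 0 by omega)
    intro j
    cases j using Fin.lastCases with
    | last => rw [htwo, if_pos (by simp)]
    | cast i => rw [hzero i (Finset.mem_univ i), if_neg (by simp [i.2.ne])]

theorem sum_mul_sub_one_eq {q : ℕ} {ε : Fin q → ℤ} {s c : ℤ} (hsum : ∑ j, (ε j - 1) = s)
    (hε : ∀ j, ε j = c ∨ ε j = 1) : ∑ j, ε j * (ε j - 1) = c * s := by
  rw [← hsum, Finset.mul_sum]
  refine Finset.sum_congr rfl fun j _ => ?_
  obtain hj | hj := hε j <;> rw [hj]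
  rw [sub_self, mul_zero, mul_zero]

theorem eq_ite_and_sum_mul_sub_one_of_sum_sub_one_eq_two {q : ℕ} {ε : Fin q → ℤ}
    (hε : Monotone ε) (hε₁ : ∀ j, 1 ≤ ε j) (hsum : ∑ j, (ε j - 1) = 2) :
    (∀ j : Fin q, ε j = if (j : ℕ) + 1 = q then 3 else 1) ∧ ∑ j, ε j * (ε j - 1) = 3 * 2 ∨
      (∀ j : Fin q, ε j = if (j : ℕ) + 1 = q ∨ (j : ℕ) + 1 = q - 1 then 2 else 1) ∧
        ∑ j, ε j * (ε j - 1) = 2 * 2 := by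
  refine (eq_ite_of_monotone_of_sum_eq_two (fun _ _ hij => sub_le_sub_right (hε hij) 1)
    (fun j => sub_nonneg.2 (hε₁ j)) hsum).imp (fun hx => ?_) fun hx => ?_ <;>
  · have hε_eq := fun j => sub_eq_iff_eq_add.1 (hx j)
    simp only [ite_add, zero_add, one_add_one_eq_two, two_add_one_eq_three] at hε_eq
    refine ⟨hε_eq, sum_mul_sub_one_eq hsum fun j => ?_⟩
    rw [hε_eq j]
    split_ifs <;> simp only [true_or, or_true]

namespace IsMinimalMilnorResolution

section

variable {d m : ℕ} {f : PolyS} {dd : Fin m → ℕ} {e : Fin (m - 2) → ℕ}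
  {ρ : Fin m → Fin 3 → PolyS} {σ : Fin (m - 2) → Fin m → PolyS}

theorem isHomogeneousMatrix_left (h : IsMinimalMilnorResolution f d dd e ρ σ) :
    IsHomogeneousMatrix (fun i => (e i : ℤ)) (fun j => (d : ℤ) - 1 + dd j) σ := fun i j =>
  mem_degreePart_iff.2 (by simpa only [sub_sub] using h.homogeneous_σ i j)

theorem exists_lt (h : IsMinimalMilnorResolution f d dd e ρ σ) (i : Fin (m - 2)) :
    ∃ j, (d : ℤ) - 1 + dd j < e i := by
  refine exists_lt_of_isHomogeneousMatrix h.isHomogeneousMatrix_left (fun hi => ?_) (h.minimal_σ i)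
  have := h.injective (a₁ := Pi.single i 1) (a₂ := 0) (by
    rw [Fintype.linearCombination_apply_single, hi, smul_zero, map_zero])
  simpa using congrFun this i

theorem two_le (h : IsMinimalMilnorResolution f d dd e ρ σ) (hf : IsReducedPlaneCurve d f) :
    2 ≤ m := by
  have hrank := finrank_range_add_finrank_ker_pi (Fintype.linearCombination PolyS ρ)
  rw [← h.exact_right.linearMap_ker_eq, ← jacobianSyzygies, hf.finrank_jacobianSyzygies,
    Fintype.card_fin] at hrank
  omega

theorem hilbertFunction_add_eq (h : IsMinimalMilnorResolution f d dd e ρ σ)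
    (hf : IsReducedPlaneCurve d f) (k : ℕ) :
    hilbertFunction (jacobianIdeal f) k +
        3 * Module.finrank ℂ (degreePart (Fin 3) ℂ (k - ((d : ℤ) - 1))) +
        ∑ i, Module.finrank ℂ (degreePart (Fin 3) ℂ (k - e i)) =
      Module.finrank ℂ (degreePart (Fin 3) ℂ k) +
        ∑ j, Module.finrank ℂ (degreePart (Fin 3) ℂ (k - ((d : ℤ) - 1 + dd j))) := by
  have hd := hf.three_le
  have hf' : ∀ i, pderiv i f ∈ degreePart (Fin 3) ℂ ((d : ℤ) - 1) := fun i => by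
    rw [← Nat.cast_pred (by omega), degreePart_natCast]
    exact hf.isHomogeneous.pderiv
  have h₁ : hilbertFunction (jacobianIdeal f) k +
      Module.finrank ℂ (gradedImage (fun _ : Fin 3 => (d : ℤ) - 1) k (jacobianMap f)) =
      Module.finrank ℂ (degreePart (Fin 3) ℂ k) :=
    hilbertFunction_add_finrank_gradedImage hf' k
  have h₂ : Module.finrank ℂ (gradedImage (fun _ : Fin 3 => (d : ℤ) - 1) k (jacobianMap f)) +
      Module.finrank ℂ (gradedImage (fun j => (d : ℤ) - 1 + dd j) k
        (Fintype.linearCombination PolyS ρ)) =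
      3 * Module.finrank ℂ (degreePart (Fin 3) ℂ (k - ((d : ℤ) - 1))) := by
    have hadd := finrank_gradedImage_add
      (isHomogeneousMatrix_of_isHomogeneous h.homogeneous_ρ ((d : ℤ) - 1)) h.exact_right k
    rwa [Fin.sum_const, smul_eq_mul] at hadd
  have h₃ : Module.finrank ℂ (gradedImage (fun j => (d : ℤ) - 1 + dd j) k
        (Fintype.linearCombination PolyS ρ)) +
      ∑ i, Module.finrank ℂ (degreePart (Fin 3) ℂ (k - e i)) =
      ∑ j, Module.finrank ℂ (degreePart (Fin 3) ℂ (k - ((d : ℤ) - 1 + dd j))) := by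
    have hadd := finrank_gradedImage_add h.isHomogeneousMatrix_left h.exact_middle k
    rwa [finrank_gradedImage_of_injective h.injective] at hadd
  omega

theorem eventually_two_mul_hilbertFunction (h : IsMinimalMilnorResolution f d dd e ρ σ)
    (hf : IsReducedPlaneCurve d f) :
    ∀ᶠ k : ℕ in Filter.atTop, 2 * (hilbertFunction (jacobianIdeal f) k : ℤ) =
      (3 * ((d : ℤ) - 1) + ∑ i, (e i : ℤ) - ∑ j, ((d : ℤ) - 1 + dd j)) * (2 * k + 3) +
        (∑ j, ((d : ℤ) - 1 + dd j) ^ 2 - ∑ i, (e i : ℤ) ^ 2 - 3 * ((d : ℤ) - 1) ^ 2) := by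
  have hrank : ∀ k : ℕ, ∀ a : ℤ, a ≤ k →
      2 * (Module.finrank ℂ (degreePart (Fin 3) ℂ (k - a)) : ℤ) =
        (k + 1) * (k + 2) - a * (2 * k + 3) + a ^ 2 := fun k a hak => by
    have := two_mul_finrank_degreePart (K := ℂ) (sub_nonneg.2 hak)
    linear_combination this
  have hlarge : ∀ a : ℤ, ∀ᶠ k : ℕ in Filter.atTop, a ≤ k :=
    fun a => tendsto_natCast_atTop_atTop.eventually_ge_atTop a
  filter_upwards [hlarge (d - 1), Filter.eventually_all.2 fun i => hlarge (e i),
    Filter.eventually_all.2 fun j => hlarge (d - 1 + dd j)] with k hk hke hkd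
  have hsum := congrArg (fun n : ℕ => (2 * n : ℤ)) (h.hilbertFunction_add_eq hf k)
  push_cast at hsum
  have he : ∑ i, 2 * (Module.finrank ℂ (degreePart (Fin 3) ℂ (k - e i)) : ℤ) =
      ∑ i, ((k + 1) * (k + 2) - (e i : ℤ) * (2 * k + 3) + (e i : ℤ) ^ 2) :=
    Finset.sum_congr rfl fun i _ => hrank k _ (hke i)
  have hdd : ∑ j, 2 * (Module.finrank ℂ (degreePart (Fin 3) ℂ (k - ((d : ℤ) - 1 + dd j))) : ℤ) =
      ∑ j, ((k + 1) * (k + 2) - ((d : ℤ) - 1 + dd j) * (2 * k + 3) + ((d : ℤ) - 1 + dd j) ^ 2) :=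
    Finset.sum_congr rfl fun j _ => hrank k _ (hkd j)
  have hk₀ := hrank k 0 (by positivity)
  rw [sub_zero] at hk₀
  rw [← Finset.mul_sum, Finset.sum_add_distrib, Finset.sum_sub_distrib, Finset.sum_const,
    Finset.card_univ, Fintype.card_fin, nsmul_eq_mul, ← Finset.sum_mul] at he hdd
  rw [Nat.cast_sub (h.two_le hf)] at he
  linear_combination hsum - 3 * hrank k _ hk + hk₀ - he + hdd

theorem sum_degrees (h : IsMinimalMilnorResolution f d dd e ρ σ) (hf : IsReducedPlaneCurve d f) :
    3 * ((d : ℤ) - 1) + ∑ i, (e i : ℤ) = ∑ j, ((d : ℤ) - 1 + dd j) := by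
  obtain ⟨N, hN⟩ := Filter.eventually_atTop.1 (h.eventually_two_mul_hilbertFunction hf)
  refine sub_eq_zero.1 ?_
  set α := 3 * ((d : ℤ) - 1) + ∑ i, (e i : ℤ) - ∑ j, ((d : ℤ) - 1 + dd j)
  refine (mul_eq_zero.1 (eq_zero_of_forall_abs_mul_add_le (N := max N (2 * (d - 1)))
    (B := 2 * ((d - 1) ^ 2 : ℕ)) (α := 2 * α) (β := 3 * α + (∑ j, ((d : ℤ) - 1 + dd j) ^ 2 -
      ∑ i, (e i : ℤ) ^ 2 - 3 * ((d : ℤ) - 1) ^ 2)) fun k hk => ?_)).resolve_left two_ne_zero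
  have hle := hf.hilbertFunction_jacobianIdeal_le ((le_max_right _ _).trans hk)
  rw [abs_le]
  have := hN k ((le_max_left _ _).trans hk)
  constructor <;> linarith [Int.ofNat_le.2 hle]

theorem eventually_two_mul_hilbertFunction_eq (h : IsMinimalMilnorResolution f d dd e ρ σ)
    (hf : IsReducedPlaneCurve d f) :
    ∀ᶠ k : ℕ in Filter.atTop, 2 * (hilbertFunction (jacobianIdeal f) k : ℤ) =
      ∑ j, ((d : ℤ) - 1 + dd j) ^ 2 - ∑ i, (e i : ℤ) ^ 2 - 3 * ((d : ℤ) - 1) ^ 2 := by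
  simpa only [h.sum_degrees hf, sub_self, zero_mul, zero_add] using
    h.eventually_two_mul_hilbertFunction hf

theorem exists_hasTotalTjurinaNumber (h : IsMinimalMilnorResolution f d dd e ρ σ)
    (hf : IsReducedPlaneCurve d f) : ∃ τ, HasTotalTjurinaNumber f τ := by
  have hev := h.eventually_two_mul_hilbertFunction_eq hf
  obtain ⟨N, hN⟩ := hev.exists
  exact ⟨hilbertFunction (jacobianIdeal f) N, hev.mono fun k hk => by omega⟩

theorem two_mul_totalTjurinaNumber (h : IsMinimalMilnorResolution f d dd e ρ σ)
    (hf : IsReducedPlaneCurve d f) {τ : ℕ} (hτ : HasTotalTjurinaNumber f τ) :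
    2 * (τ : ℤ) =
      ∑ j, ((d : ℤ) - 1 + dd j) ^ 2 - ∑ i, (e i : ℤ) ^ 2 - 3 * ((d : ℤ) - 1) ^ 2 := by
  obtain ⟨k, hk, hkτ⟩ := ((h.eventually_two_mul_hilbertFunction_eq hf).and hτ).exists
  rwa [hkτ] at hk

end

section Equigenerated

variable {d r m : ℕ} {f : PolyS} {e : Fin (m - 2) → ℕ}
  {ρ : Fin m → Fin 3 → PolyS} {σ : Fin (m - 2) → Fin m → PolyS}

theorem one_le_resolutionEpsilon (h : IsMinimalMilnorResolution f d (fun _ => r) e ρ σ)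
    (j : Fin (m - 2)) : 1 ≤ resolutionEpsilon d (fun _ : Fin m => r) e j := by
  obtain ⟨_, hj⟩ := h.exists_lt j
  rw [resolutionEpsilon]
  omega

theorem monotone_resolutionEpsilon (h : IsMinimalMilnorResolution f d (fun _ => r) e ρ σ) :
    Monotone (resolutionEpsilon d (fun _ : Fin m => r) e) := fun _ _ hij =>
  sub_le_sub_right (Int.ofNat_le.2 (h.monotone_e hij)) _

theorem sum_resolutionEpsilon_sub_one (h : IsMinimalMilnorResolution f d (fun _ => r) e ρ σ)
    (hf : IsReducedPlaneCurve d f) :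
    ∑ j, (resolutionEpsilon d (fun _ : Fin m => r) e j - 1) = deltaM d r m := by
  have hsum := h.sum_degrees hf
  simp only [resolutionEpsilon, deltaM, Finset.sum_sub_distrib, Finset.sum_const,
    Finset.card_univ, Fintype.card_fin, nsmul_eq_mul, Nat.cast_sub (h.two_le hf)] at hsum ⊢
  push_cast
  linear_combination hsum

theorem two_mul_totalTjurinaNumber_add_sum
    (h : IsMinimalMilnorResolution f d (fun _ => r) e ρ σ) (hf : IsReducedPlaneCurve d f) {τ : ℕ}
    (hτ : HasTotalTjurinaNumber f τ) :
    2 * (τ : ℤ) + ∑ j, resolutionEpsilon d (fun _ : Fin m => r) e j *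
        (resolutionEpsilon d (fun _ : Fin m => r) e j - 1) =
      d * ((d : ℤ) - 1) + 2 * r * ((d : ℤ) - r - 2) := by
  have hsum := h.sum_resolutionEpsilon_sub_one hf
  have hτ' := h.two_mul_totalTjurinaNumber hf hτ
  have hsq : ∑ j, (e j : ℤ) ^ 2 = ∑ j, ((d + r - 1 : ℤ) ^ 2 +
      (2 * (d + r) - 1) * resolutionEpsilon d (fun _ : Fin m => r) e j +
      resolutionEpsilon d (fun _ : Fin m => r) e j *
        (resolutionEpsilon d (fun _ : Fin m => r) e j - 1)) :=
    Finset.sum_congr rfl fun j _ => by rw [resolutionEpsilon]; ring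
  simp only [Finset.sum_add_distrib, Finset.sum_sub_distrib, ← Finset.mul_sum, Finset.sum_const,
    Finset.card_univ, Fintype.card_fin, nsmul_eq_mul, Nat.cast_sub (h.two_le hf)]
    at hsq hsum hτ'
  rw [deltaM] at hsum
  push_cast at hsum hsq
  linear_combination hτ' - hsq - (2 * (d + r : ℤ) - 1) * hsum

end Equigenerated

end IsMinimalMilnorResolution

theorem mainTheorem4_general (d r m : ℕ) (f : PolyS) (hC : IsCurveOfType d r m f)
    (hΔ : deltaM d r m = 2) :
    ∃ τ : ℕ, HasTotalTjurinaNumber f τ ∧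
      (∃ (e : Fin (m - 2) → ℕ) (ρ : Fin m → Fin 3 → PolyS) (σ : Fin (m - 2) → Fin m → PolyS),
        IsMinimalMilnorResolution f d (fun _ => r) e ρ σ) ∧
      ∀ (e : Fin (m - 2) → ℕ) (ρ : Fin m → Fin 3 → PolyS) (σ : Fin (m - 2) → Fin m → PolyS),
        IsMinimalMilnorResolution f d (fun _ => r) e ρ σ →
        Xor
          ((∀ j : Fin (m - 2), resolutionEpsilon d (fun _ : Fin m => r) e j =
              if (j : ℕ) + 1 = m - 2 then 3 else 1) ∧
            (τ : ℚ) = (d : ℚ) * ((d : ℚ) - 1) / 2 - 3 + (r : ℚ) * ((d : ℚ) - r - 2))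
          ((∀ j : Fin (m - 2), resolutionEpsilon d (fun _ : Fin m => r) e j =
              if (j : ℕ) + 1 = m - 2 ∨ (j : ℕ) + 1 = m - 3 then 2 else 1) ∧
            (τ : ℚ) = (d : ℚ) * ((d : ℚ) - 1) / 2 - 2 + (r : ℚ) * ((d : ℚ) - r - 2)) := by
  obtain ⟨hf, ρ₀, hρ₀⟩ := hC
  have hr : r ≠ 0 := by have := hf.three_le; rw [deltaM] at hΔ; omega
  obtain ⟨e₀, σ₀, h₀⟩ := hf.exists_isMinimalMilnorResolution hρ₀ fun _ => hr
  obtain ⟨τ, hτ⟩ := h₀.exists_hasTotalTjurinaNumber hf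
  refine ⟨τ, hτ, ⟨e₀, ρ₀, σ₀, h₀⟩, fun e ρ σ h => (xor_iff_or_and_not_and _ _).2
    ⟨?_, fun ⟨hone, htwo⟩ => by linarith [hone.2, htwo.2]⟩⟩
  have hτ' := congrArg (Int.cast : ℤ → ℚ) (h.two_mul_totalTjurinaNumber_add_sum hf hτ)
  refine (eq_ite_and_sum_mul_sub_one_of_sum_sub_one_eq_two h.monotone_resolutionEpsilon
    h.one_le_resolutionEpsilon ((h.sum_resolutionEpsilon_sub_one hf).trans hΔ)).imp ?_ ?_ <;>
  · rintro ⟨hε, hsum⟩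
    rw [hsum] at hτ'
    push_cast at hτ'
    exact ⟨fun j => by simp [hε j, Nat.sub_sub], by linear_combination hτ' / 2⟩

theorem mainTheorem4 (d r m : ℕ) (f : PolyS) (hC : IsCurveOfType d r m f)
    (hm : 3 < m) (hΔ : deltaM d r m = 2) :
    ∃ τ : ℕ, HasTotalTjurinaNumber f τ ∧
      (∃ (e : Fin (m - 2) → ℕ) (ρ : Fin m → Fin 3 → PolyS) (σ : Fin (m - 2) → Fin m → PolyS),
        IsMinimalMilnorResolution f d (fun _ => r) e ρ σ) ∧
      ∀ (e : Fin (m - 2) → ℕ) (ρ : Fin m → Fin 3 → PolyS) (σ : Fin (m - 2) → Fin m → PolyS),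
        IsMinimalMilnorResolution f d (fun _ => r) e ρ σ →
        Xor
          ((∀ j : Fin (m - 2), resolutionEpsilon d (fun _ : Fin m => r) e j =
              if (j : ℕ) + 1 = m - 2 then 3 else 1) ∧
            (τ : ℚ) = (d : ℚ) * ((d : ℚ) - 1) / 2 - 3 + (r : ℚ) * ((d : ℚ) - r - 2))
          ((∀ j : Fin (m - 2), resolutionEpsilon d (fun _ : Fin m => r) e j =
              if (j : ℕ) + 1 = m - 2 ∨ (j : ℕ) + 1 = m - 3 then 2 else 1) ∧
            (τ : ℚ) = (d : ℚ) * ((d : ℚ) - 1) / 2 - 2 + (r : ℚ) * ((d : ℚ) - r - 2)) :=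
  mainTheorem4_general d r m f hC hΔ
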